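/- **Definitions.** A real $n\times n$ matrix $A$ has the *non-symmetric strong multiplicity property* (nSMP) if $X=O$ is the only real $n\times n$ matrix with $A\circ X=O$, $AX^T-X^TA=O$ and $\operatorname{tr}(X^TA^k)=0$ for $0\le k<n$, where $\circ$ is the entrywise product. A *sign pattern* $\mathcal A$ is a square matrix with entries in $\{+,-,0\}$; $Q(\mathcal A)$ is the set of real matrices of the same order whose entries have the signs prescribed by $\mathcal A$. The pattern $\mathcal A$ *requires* (respectively *allows*) the nSMP if every (respectively some) matrix in $Q(\mathcal A)$ has the nSMP. It is *reducible* if some simultaneous permutation of its rows and columns makes it block upper triangular with two square diagonal blocks of positive order. Two sign patterns are *equivalent* if one can be obtained from the other by a finite sequence of permutation similarities, signature similarities ($M\mapsto DMD$ with $D$ diagonal with diagonal entries $\pm1$), transpositions and negations. In a matrix of symbols, $*$, $\oplus$, $\ominus$, $\circledast$ stand for a nonzero, nonnegative, nonpositive and arbitrary real number, respectively, and $+$, $-$, $0$ for a positive, negative and zero number; for such a matrix $\mathcal B$, $Q(\mathcal B)$ is the set of the real matrices so described. A sign pattern $\mathcal A$ is a *fixed signing* of $\mathcal B$ if $Q(\mathcal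 A)\subseteq Q(\mathcal B)$. **Theorem.** Let $\mathcal A$ be a reducible $3\times3$ sign pattern. (1) $\mathcal A$ requires the nSMP if and only if $\mathcal A$ is equivalent to a fixed signing of one of $$\mathcal A_1=\begin{bmatrix}\circledast&*&\circledast\\ *&0&\circledast\\ 0&0&0\end{bmatrix},\quad \mathcal A_2=\begin{bmatrix}+&\oplus&\circledast\\ +&-&\circledast\\ 0&0&0\end{bmatrix},\quad \mathcal A_3=\begin{bmatrix}+&+&\circledast\\ -&+&\circledast\\ 0&0&0\end{bmatrix},$$ $$\mathcal A_4=\begin{bmatrix}\ominus&+&\circledast\\ -&\ominus&\circledast\\ 0&0&+\end{bmatrix},\quad \mathcal A_5=\begin{bmatrix}-&\circledast&\circledast\\ 0&0&\circledast\\ 0&0&+\end{bmatrix},\quad \mathcal A_6=\begin{bmatrix}0&\circledast&\circledast\\ 0&-&\circledast\\ 0&0&+\end{bmatrix}.$$ (2) $\mathcal A$ allows but does not require the nSMP if and only if $\mathcal A$ is equivalent to a fixed signing of one of $$\mathcal B_1=\begin{bmatrix}+&+&\circledast\\ +&+&\circledast\\ 0&0&0\end{bmatrix},\quad \mathcal B_2=\begin{bmatrix}+&+&\circledast\\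 -&-&\circledast\\ 0&0&0\end{bmatrix},\quad \mathcal B_3=\begin{bmatrix}+&+&\circledast\\ -&\circledast&\circledast\\ 0&0&+\end{bmatrix},$$ $$\mathcal B_4=\begin{bmatrix}\circledast&+&\circledast\\ +&\circledast&\circledast\\ 0&0&+\end{bmatrix},\quad \mathcal B_5=\begin{bmatrix}+&\circledast&\circledast\\ 0&\circledast&\circledast\\ 0&0&+\end{bmatrix},\quad \mathcal B_6=\begin{bmatrix}\ominus&\circledast&\circledast\\ 0&+&\circledast\\ 0&0&+\end{bmatrix}.$$ -/

import Mathlib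

open scoped Matrix

namespace NSMP

/-- A real `n × n` matrix `A` has the non-symmetric strong multiplicity property: the system
`A ∘ X = 0`, `A Xᵀ - Xᵀ A = 0`, `tr (Xᵀ A ^ k) = 0` for `0 ≤ k < n` has only the trivial
(real) solution `X = 0`. Here `⊙` is the Hadamard (entrywise) product. -/
def HasNSMP {n : ℕ} (A : Matrix (Fin n) (Fin n) ℝ) : Prop :=
  ∀ X : Matrix (Fin n) (Fin n) ℝ,
    A ⊙ X = 0 → A * Xᵀ - Xᵀ * A = 0 →
    (∀ k : ℕ, k < n → Matrix.trace (Xᵀ * A ^ k) = 0) → X = 0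

/-- A sign pattern: a matrix with entries in `{+, -, 0}`, written `1`, `-1`, `0` in `SignType`. -/
abbrev SignPattern (n : ℕ) := Matrix (Fin n) (Fin n) SignType

/-- The qualitative class of a sign pattern: the real matrices with the prescribed signs. -/
def qualClass {n : ℕ} (A : SignPattern n) : Set (Matrix (Fin n) (Fin n) ℝ) :=
  {M | ∀ i j, SignType.sign (M i j) = A i j}

/-- `A` requires the property `P`: every realization has `P`. -/
def Requires {n : ℕ} (A : SignPattern n) (P : Matrix (Fin n) (Fin n) ℝ → Prop) : Prop :=
  ∀ M ∈ qualClass A, P M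

/-- `A` allows the property `P`: some realization has `P`. -/
def Allows {n : ℕ} (A : SignPattern n) (P : Matrix (Fin n) (Fin n) ℝ → Prop) : Prop :=
  ∃ M ∈ qualClass A, P M

/-- `A` is reducible: after a simultaneous permutation of rows and columns it is block upper
triangular with two square diagonal blocks, of the positive orders `k` and `n - k`. -/
def Reducible {n : ℕ} (A : SignPattern n) : Prop :=
  ∃ (σ : Equiv.Perm (Fin n)) (k : ℕ), 0 < k ∧ k < n ∧
    ∀ i j : Fin n, k ≤ (i : ℕ) → (j : ℕ) < k → A.submatrix σ σ i j = 0

/-- `A` is permutationally similar to `B`. -/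
def PermSimilar {n : ℕ} (A B : SignPattern n) : Prop :=
  ∃ σ : Equiv.Perm (Fin n), B = A.submatrix σ σ

/-- `A` is signature similar to `B`: for some diagonal matrix `D` with diagonal entries `± 1`,
`D M D` is a realization of `B` for every realization `M` of `A`. -/
def SignatureSimilar {n : ℕ} (A B : SignPattern n) : Prop :=
  ∃ d : Fin n → ℝ, (∀ i, d i = 1 ∨ d i = -1) ∧
    ∀ M ∈ qualClass A, Matrix.diagonal d * M * Matrix.diagonal d ∈ qualClass B

/-- `B` is obtained from `A` by one permutation similarity, signature similarity, transposition
or negation. -/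
def EquivStep {n : ℕ} (A B : SignPattern n) : Prop :=
  PermSimilar A B ∨ SignatureSimilar A B ∨ B = Aᵀ ∨ B = A.map (fun s => -s)

/-- `A` and `B` are equivalent: one is obtained from the other by finitely many such operations. -/
def Equivalent {n : ℕ} : SignPattern n → SignPattern n → Prop :=
  Relation.ReflTransGen EquivStep

/-- The symbols `+`, `-`, `0`, `*`, `⊕`, `⊖`, `⊛` of relaxed sign patterns. -/
inductive Symb where
  | pos
  | neg
  | zero
  | nonzero
  | nonneg
  | nonpos
  | arb

/-- The set of real numbers that a symbol stands for. -/
def Symb.toSet : Symb → Set ℝ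
  | .pos => {x | 0 < x}
  | .neg => {x | x < 0}
  | .zero => {0}
  | .nonzero => {x | x ≠ 0}
  | .nonneg => {x | 0 ≤ x}
  | .nonpos => {x | x ≤ 0}
  | .arb => Set.univ

/-- A relaxed sign pattern: a matrix of symbols. -/
abbrev SPattern (n : ℕ) := Matrix (Fin n) (Fin n) Symb

/-- The qualitative class of a relaxed sign pattern. -/
def SPattern.qualClass {n : ℕ} (B : SPattern n) : Set (Matrix (Fin n) (Fin n) ℝ) :=
  {M | ∀ i j, M i j ∈ (B i j).toSet}

/-- The sign pattern `A` is a fixed signing of `B`: `B` is a relaxation of `A`, that is, every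
realization of `A` is a realization of `B`. -/
def IsFixedSigning {n : ℕ} (A : SignPattern n) (B : SPattern n) : Prop :=
  qualClass A ⊆ SPattern.qualClass B

open Symb

/-- The six patterns `A₁, …, A₆`. -/
def patternsA : Fin 6 → SPattern 3 :=
  ![!![arb,    nonzero, arb;
       nonzero, zero,   arb;
       zero,   zero,    zero],
    !![pos,    nonneg,  arb;
       pos,    neg,     arb;
       zero,   zero,    zero],
    !![pos,    pos,     arb;
       neg,    pos,     arb;
       zero,   zero,    zero],
    !![nonpos, pos,     arb;
       neg,    nonpos,  arb;
       zero,   zero,    pos],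
    !![neg,    arb,     arb;
       zero,   zero,    arb;
       zero,   zero,    pos],
    !![zero,   arb,     arb;
       zero,   neg,     arb;
       zero,   zero,    pos]]

/-- The six patterns `B₁, …, B₆`. -/
def patternsB : Fin 6 → SPattern 3 :=
  ![!![pos,    pos,     arb;
       pos,    pos,     arb;
       zero,   zero,    zero],
    !![pos,    pos,     arb;
       neg,    neg,     arb;
       zero,   zero,    zero],
    !![pos,    pos,     arb;
       neg,    arb,     arb;
       zero,   zero,    pos],
    !![arb,    pos,     arb;
       pos,    arb,     arb;
       zero,   zero,    pos],
    !![pos,    arb,     arb;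
       zero,   arb,     arb;
       zero,   zero,    pos],
    !![nonpos, arb,     arb;
       zero,   pos,     arb;
       zero,   zero,    pos]]

end NSMP

/-!
# Reducible sign patterns of order three and the non-symmetric strong multiplicity property

A matrix with diagonal blocks `[a, b; d, e]` and `[g]` has the nSMP if and only if `g` is not an
eigenvalue of the first block and, when that block is triangular, its diagonal entries differ.
-/

namespace NSMP

/-! ### Invariance of the nSMP -/

section Invariance

variable {n : ℕ}

/-! Equivalence preserves the nSMP realization by realization, and every reducible pattern of order
three is equivalent to one with diagonal blocks `B = [a, b; d, e]` and `[g]`. Everything then rests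
on the criterion `hasNSMP_blockTri_iff`, in which `c` and `f` play no role. If it fails, a rank-one
`Xᵀ = v wᵀ` breaks the nSMP, where `v` and `w` are right and left eigenvectors for one eigenvalue
and `wᵀ v = 0`. If it holds, commutation makes `Xᵀ` block triangular; its diagonal part dies by a
Vandermonde argument when `b * d = 0`, and otherwise because it is `diag(s, s, -2s)` and the trace
conditions would force `g` to be an eigenvalue of `B` unless `s = 0`. For signs, the criterion
compares `(a - g)(e - g)` with `b * d`. The inequality is automatic on `patternsA`; on `patternsB`
magnitudes can be chosen either way. A finite check, `Reducible.classified`, shows that any other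
reducible pattern does not allow the nSMP, and this trichotomy yields both equivalences. -/

theorem HasNSMP.transpose {A : Matrix (Fin n) (Fin n) ℝ} (h : HasNSMP A) : HasNSMP Aᵀ := by
  intro X h1 h2 h3
  rw [← Matrix.transpose_eq_zero]
  refine h Xᵀ ?_ ?_ fun k hk => ?_
  · ext i j
    simpa using congrFun (congrFun h1 j) i
  · have := congrArg Matrix.transpose h2
    simp only [Matrix.transpose_sub, Matrix.transpose_mul, Matrix.transpose_transpose,
      Matrix.transpose_zero] at this ⊢
    rw [← neg_sub, this, neg_zero]
  · rw [← h3 k hk, ← Matrix.trace_transpose, Matrix.transpose_mul, Matrix.transpose_pow,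
      Matrix.transpose_transpose, Matrix.trace_mul_comm]

theorem HasNSMP.neg {A : Matrix (Fin n) (Fin n) ℝ} (h : HasNSMP A) : HasNSMP (-A) := by
  intro X h1 h2 h3
  refine h X ?_ ?_ fun k hk => ?_
  · ext i j
    simpa using congrFun (congrFun h1 i) j
  · rw [← neg_eq_zero, ← h2]
    simp only [Matrix.neg_mul, Matrix.mul_neg]
    abel
  · have := h3 k hk
    rw [neg_pow, ← mul_assoc] at this
    rcases neg_one_pow_eq_or (Matrix (Fin n) (Fin n) ℝ) k with h' | h' <;>
      simpa [h'] using this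

theorem HasNSMP.submatrix {A : Matrix (Fin n) (Fin n) ℝ} (h : HasNSMP A)
    (σ : Equiv.Perm (Fin n)) : HasNSMP (A.submatrix σ σ) := by
  intro X h1 h2 h3
  -- Reindexing by `σ` is an algebra isomorphism, so it carries products and powers across.
  have hA : A = Matrix.reindexAlgEquiv ℝ ℝ σ (A.submatrix σ σ) := by ext; simp
  have hX : (X.submatrix σ.symm σ.symm)ᵀ = Matrix.reindexAlgEquiv ℝ ℝ σ Xᵀ := by ext; simp
  have key : X.submatrix σ.symm σ.symm = 0 := by
    refine h _ ?_ ?_ fun k hk => ?_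
    · ext i j
      simpa using congrFun (congrFun h1 (σ.symm i)) (σ.symm j)
    · rw [hX, hA, ← map_mul, ← map_mul, ← map_sub, h2, map_zero]
    · rw [hX, hA, ← map_pow, ← map_mul, ← h3 k hk]
      simp [Matrix.trace, Equiv.sum_comp σ.symm
        (fun i => (Xᵀ * A.submatrix σ σ ^ k) i i)]
  ext i j
  simpa using congrFun (congrFun key (σ i)) (σ j)

theorem diagonal_mul_self_of_signs {d : Fin n → ℝ} (hd : ∀ i, d i = 1 ∨ d i = -1) :
    Matrix.diagonal d * Matrix.diagonal d = 1 := by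
  rw [Matrix.diagonal_mul_diagonal, ← Matrix.diagonal_one]
  congr 1
  ext i
  rcases hd i with h | h <;> simp [h]

theorem HasNSMP.signature {A : Matrix (Fin n) (Fin n) ℝ} (h : HasNSMP A)
    {d : Fin n → ℝ} (hd : ∀ i, d i = 1 ∨ d i = -1) :
    HasNSMP (Matrix.diagonal d * A * Matrix.diagonal d) := by
  intro X h1 h2 h3
  have hD := diagonal_mul_self_of_signs hd
  have hDD (Y : Matrix (Fin n) (Fin n) ℝ) : Matrix.diagonal d * (Matrix.diagonal d * Y) = Y := by
    rw [← mul_assoc, hD, one_mul]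
  have hpow (k : ℕ) : (Matrix.diagonal d * A * Matrix.diagonal d) ^ k =
      Matrix.diagonal d * A ^ k * Matrix.diagonal d := by
    induction k with
    | zero => simp [hD]
    | succ k ih => rw [pow_succ, ih, pow_succ]; simp only [mul_assoc, hDD]
  have key : Matrix.diagonal d * X * Matrix.diagonal d = 0 := by
    refine h _ ?_ ?_ fun k hk => ?_
    · ext i j
      have := congrFun (congrFun h1 i) j
      simp only [Matrix.hadamard_apply, Matrix.mul_diagonal, Matrix.diagonal_mul,
        Matrix.zero_apply] at this ⊢
      linear_combination this
    · have := congrArg (fun Y => Matrix.diagonal d * Y * Matrix.diagonal d) h2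
      simpa only [mul_sub, sub_mul, Matrix.transpose_mul, Matrix.diagonal_transpose, mul_assoc, hDD,
        hD, mul_one, mul_zero, zero_mul] using this
    · have := h3 k hk
      rw [hpow] at this
      rw [← this, Matrix.transpose_mul, Matrix.transpose_mul, Matrix.diagonal_transpose]
      simp only [← mul_assoc]
      rw [Matrix.trace_mul_comm _ (Matrix.diagonal d)]
      simp only [← mul_assoc]
  have := congrArg (fun Y => Matrix.diagonal d * Y * Matrix.diagonal d) key
  simpa only [mul_assoc, hDD, hD, mul_one, mul_zero, zero_mul] using this

end Invariance

/-! ### Invariance of `Requires` and `Allows` under equivalence -/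

section Equivalence

variable {n : ℕ} {A B : SignPattern n}

theorem sign_coe_signType (s : SignType) : SignType.sign (s : ℝ) = s := by
  cases s <;> simp

/-- The realization with entries in `{-1, 0, 1}` makes every class nonempty, so statements about all
realizations can be read back on signs. -/
theorem cast_mem_qualClass (A : SignPattern n) :
    (Matrix.of fun i j => ((A i j : SignType) : ℝ)) ∈ qualClass A := fun i j => by
  simp [sign_coe_signType]

theorem SignatureSimilar.eq {d : Fin n → ℝ}
    (h : ∀ M ∈ qualClass A, Matrix.diagonal d * M * Matrix.diagonal d ∈ qualClass B) (i j : Fin n) :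
    B i j = SignType.sign (d i) * A i j * SignType.sign (d j) := by
  have := h _ (cast_mem_qualClass A) i j
  simpa [sign_mul, sign_coe_signType] using this.symm

theorem EquivStep.symm (h : EquivStep A B) : EquivStep B A := by
  rcases h with ⟨σ, rfl⟩ | ⟨d, hd, h⟩ | rfl | rfl
  · exact .inl ⟨σ.symm, by ext; simp⟩
  · refine .inr (.inl ⟨d, hd, fun M hM i j => ?_⟩)
    have hM' := hM i j
    rw [SignatureSimilar.eq h] at hM'
    simp only [Matrix.mul_diagonal, Matrix.diagonal_mul, sign_mul, hM']
    rcases hd i with hi | hi <;> rcases hd j with hj | hj <;> simp [hi, hj]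
  · exact .inr (.inr (.inl (by simp)))
  · exact .inr (.inr (.inr (by ext; simp)))

/-- Every realization of `A` is carried to one of `B` by an operation that preserves the nSMP
in both directions. -/
theorem EquivStep.exists_map (h : EquivStep A B) {M : Matrix (Fin n) (Fin n) ℝ}
    (hM : M ∈ qualClass A) : ∃ N ∈ qualClass B, (HasNSMP M ↔ HasNSMP N) := by
  rcases h with ⟨σ, rfl⟩ | ⟨d, hd, h⟩ | rfl | rfl
  · refine ⟨M.submatrix σ σ, fun i j => hM _ _, fun h => h.submatrix σ, fun h => ?_⟩
    simpa using h.submatrix σ.symm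
  · refine ⟨_, h M hM, fun h => h.signature hd, fun h => ?_⟩
    have h' := h.signature hd
    have hD := diagonal_mul_self_of_signs hd
    rwa [show Matrix.diagonal d * (Matrix.diagonal d * M * Matrix.diagonal d) * Matrix.diagonal d =
      (Matrix.diagonal d * Matrix.diagonal d) * M * (Matrix.diagonal d * Matrix.diagonal d) by
        simp only [mul_assoc], hD, one_mul, mul_one] at h'
  · exact ⟨Mᵀ, fun i j => hM _ _, fun h => h.transpose, fun h => by simpa using h.transpose⟩
  · refine ⟨-M, fun i j => ?_, fun h => h.neg, fun h => by simpa using h.neg⟩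
    simp [Left.sign_neg, hM i j]

theorem Equivalent.symm (h : Equivalent A B) : Equivalent B A := by
  induction h with
  | refl => exact .refl
  | tail _ h ih => exact ih.head h.symm

theorem Equivalent.exists_map (h : Equivalent A B) {M : Matrix (Fin n) (Fin n) ℝ}
    (hM : M ∈ qualClass A) : ∃ N ∈ qualClass B, (HasNSMP M ↔ HasNSMP N) := by
  induction h with
  | refl => exact ⟨M, hM, Iff.rfl⟩
  | tail _ h ih =>
    obtain ⟨N, hN, hMN⟩ := ih
    obtain ⟨N', hN', hNN'⟩ := h.exists_map hN
    exact ⟨N', hN', hMN.trans hNN'⟩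

theorem Equivalent.requires_iff (h : Equivalent A B) :
    Requires A HasNSMP ↔ Requires B HasNSMP := by
  constructor <;> intro hr M hM
  · obtain ⟨N, hN, hMN⟩ := h.symm.exists_map hM
    exact hMN.2 (hr N hN)
  · obtain ⟨N, hN, hMN⟩ := h.exists_map hM
    exact hMN.2 (hr N hN)

theorem Equivalent.allows_iff (h : Equivalent A B) : Allows A HasNSMP ↔ Allows B HasNSMP := by
  constructor <;> rintro ⟨M, hM, hM'⟩
  · obtain ⟨N, hN, hMN⟩ := h.exists_map hM
    exact ⟨N, hN, hMN.1 hM'⟩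
  · obtain ⟨N, hN, hMN⟩ := h.symm.exists_map hM
    exact ⟨N, hN, hMN.1 hM'⟩

theorem Requires.allows (h : Requires A HasNSMP) : Allows A HasNSMP :=
  ⟨_, cast_mem_qualClass A, h _ (cast_mem_qualClass A)⟩

end Equivalence

/-! ### The nSMP of a block upper triangular matrix of order three -/

/-- The block upper triangular matrix with diagonal blocks `[a, b; d, e]` and `[g]`. -/
abbrev blockTri {R : Type*} [Zero R] (a b c d e f g : R) : Matrix (Fin 3) (Fin 3) R :=
  !![a, b, c; d, e, f; 0, 0, g]

theorem exists_null_vector {a b d e : ℝ} (h : a * e = b * d) :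
    ∃ v w : ℝ, (v ≠ 0 ∨ w ≠ 0) ∧ a * v + b * w = 0 ∧ d * v + e * w = 0 := by
  by_cases h1 : a = 0 ∧ b = 0
  · by_cases h2 : d = 0 ∧ e = 0
    · exact ⟨1, 0, by simp, by simp [h1.1], by simp [h2.1]⟩
    · refine ⟨-e, d, ?_, by simp [h1.1, h1.2], by ring⟩
      rw [neg_ne_zero]; tauto
  · refine ⟨-b, a, ?_, by ring, by linear_combination h⟩
    rw [neg_ne_zero]; tauto

/-- The witness has `Xᵀ = (v, w, 0)ᵀ (0, 0, 1)`, a right times a left eigenvector for `g`. They are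
orthogonal, so all the traces vanish, and `X` lives on the zero entries of the last row. -/
theorem not_hasNSMP_of_eigenvalue {a b c d e f g : ℝ} (h : (a - g) * (e - g) = b * d) :
    ¬ HasNSMP (blockTri a b c d e f g) := by
  obtain ⟨v, w, hvw, h1, h2⟩ := exists_null_vector h
  intro H
  have := H !![0, 0, 0; 0, 0, 0; v, w, 0] ?_ ?_ ?_
  · have hv := congrFun (congrFun this 2) 0
    have hw := congrFun (congrFun this 2) 1
    simp at hv hw
    tauto
  · ext i j; fin_cases i <;> fin_cases j <;> simp
  · ext i j
    fin_cases i <;> fin_cases j <;> simp [Matrix.mul_apply, Fin.sum_univ_three, -Matrix.cons_mul]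
    · linear_combination h1
    · linear_combination h2
  · intro k hk
    interval_cases k <;>
      simp [pow_two, Matrix.trace, Matrix.mul_apply, Fin.sum_univ_three]

/-- Again an outer product of orthogonal eigenvectors, now for `a`: with `b = 0` the right one is
`(0, 1, 0)` and the left one `(a - g, 0, c)`; with `d = 0` they are `(1, 0, 0)` and `(0, a - g, f)`.
-/
theorem not_hasNSMP_of_eq {a b c d f g : ℝ} (h : b * d = 0) (hg : a ≠ g) :
    ¬ HasNSMP (blockTri a b c d a f g) := by
  have hg' : a - g ≠ 0 := sub_ne_zero.2 hg
  intro H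
  rcases mul_eq_zero.1 h with rfl | rfl
  · have := H !![0, a - g, 0; 0, 0, 0; 0, c, 0] ?_ ?_ ?_
    · have hv := congrFun (congrFun this 0) 1
      simp at hv
      exact hg' hv
    · ext i j; fin_cases i <;> fin_cases j <;> simp
    · ext i j
      fin_cases i <;> fin_cases j <;> simp [Matrix.mul_apply, Fin.sum_univ_three, -Matrix.cons_mul] <;> ring
    · intro k hk
      interval_cases k <;>
        simp [pow_two, Matrix.trace, Matrix.mul_apply, Fin.sum_univ_three]
  · have := H !![0, 0, 0; a - g, 0, 0; f, 0, 0] ?_ ?_ ?_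
    · have hv := congrFun (congrFun this 1) 0
      simp at hv
      exact hg' hv
    · ext i j; fin_cases i <;> fin_cases j <;> simp
    · ext i j
      fin_cases i <;> fin_cases j <;> simp [Matrix.mul_apply, Fin.sum_univ_three, -Matrix.cons_mul] <;> ring
    · intro k hk
      interval_cases k <;>
        simp [pow_two, Matrix.trace, Matrix.mul_apply, Fin.sum_univ_three]

theorem eq_zero_of_det_ne_zero {a b d e v w : ℝ} (h : a * e ≠ b * d)
    (h1 : a * v + b * w = 0) (h2 : d * v + e * w = 0) : v = 0 ∧ w = 0 := by
  have h' : a * e - b * d ≠ 0 := sub_ne_zero.2 h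
  constructor
  · refine (mul_eq_zero.1 (?_ : (a * e - b * d) * v = 0)).resolve_left h'
    linear_combination e * h1 - b * h2
  · refine (mul_eq_zero.1 (?_ : (a * e - b * d) * w = 0)).resolve_left h'
    linear_combination a * h2 - d * h1

theorem eq_zero_of_vandermonde {a e g x y z : ℝ} (h1 : a ≠ e) (h2 : a ≠ g) (h3 : e ≠ g)
    (h : x + y + z = 0) (h' : x * a + y * e + z * g = 0)
    (h'' : x * a ^ 2 + y * e ^ 2 + z * g ^ 2 = 0) : x = 0 ∧ y = 0 ∧ z = 0 := by
  have k1 := sub_ne_zero.2 h1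
  have k2 := sub_ne_zero.2 h2
  have k3 := sub_ne_zero.2 h3
  -- Test the three moments against `(t - e)(t - g)`, which vanishes at the other two nodes;
  -- likewise for `y`.
  have hx : x = 0 := by
    refine (mul_eq_zero.1 (?_ : ((a - e) * (a - g)) * x = 0)).resolve_left (mul_ne_zero k1 k2)
    linear_combination h'' - (e + g) * h' + e * g * h
  have hy : y = 0 := by
    refine (mul_eq_zero.1 (?_ : ((a - e) * (e - g)) * y = 0)).resolve_left (mul_ne_zero k1 k3)
    linear_combination -h'' + (a + g) * h' - a * g * h
  exact ⟨hx, hy, by linear_combination h - hx - hy⟩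

theorem hasNSMP_blockTri {a b c d e f g : ℝ} (h : (a - g) * (e - g) ≠ b * d)
    (h' : b * d = 0 → a ≠ e) : HasNSMP (blockTri a b c d e f g) := by
  intro X h1 h2 h3
  obtain ⟨p, q, u, r, s, v, x, y, z, rfl⟩ : ∃ p q u r s v x y z : ℝ,
    X = !![p, q, u; r, s, v; x, y, z] := ⟨_, _, _, _, _, _, _, _, _, Matrix.eta_fin_three X⟩
  have e01 := congrFun (congrFun h1 0) 1
  have e10 := congrFun (congrFun h1 1) 0
  have c01 := congrFun (congrFun h2 0) 1
  have c02 := congrFun (congrFun h2 0) 2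
  have c10 := congrFun (congrFun h2 1) 0
  have c12 := congrFun (congrFun h2 1) 2
  have c20 := congrFun (congrFun h2 2) 0
  have c21 := congrFun (congrFun h2 2) 1
  have t0 := h3 0 (by norm_num)
  have t1 := h3 1 (by norm_num)
  have t2 := h3 2 (by norm_num)
  simp [pow_two, Matrix.trace, Matrix.mul_apply, Fin.sum_univ_three, -Matrix.cons_mul]
    at e01 e10 c01 c02 c10 c12 c20 c21 t0 t1 t2
  clear h1 h2 h3
  -- The last row of the commutation relation says that `(u, v)` is a left null vector of the block
  -- minus `g`.
  obtain ⟨rfl, rfl⟩ : u = 0 ∧ v = 0 :=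
    eq_zero_of_det_ne_zero (a := a - g) (b := d) (d := b) (e := e - g)
      (by rwa [mul_comm d b]) (by linear_combination -c20) (by linear_combination -c21)
  have key : p = 0 ∧ q = 0 ∧ r = 0 ∧ s = 0 ∧ z = 0 := by
    by_cases hbd : b * d = 0
    · have hag : a ≠ g := fun hh => h (by rw [hh, hbd, sub_self, zero_mul])
      have heg : e ≠ g := fun hh => h (by rw [hh, hbd, sub_self, mul_zero])
      have hae := h' hbd
      have hae' := sub_ne_zero.2 hae
      rcases mul_eq_zero.1 hbd with rfl | rfl
      · have x1 : r = 0 := by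
          refine (mul_eq_zero.1 (?_ : (a - e) * r = 0)).resolve_left hae'
          linear_combination c01
        subst x1
        obtain ⟨rfl, rfl, rfl⟩ := eq_zero_of_vandermonde hae hag heg t0
          (by linear_combination t1) (by linear_combination t2)
        refine ⟨rfl, ?_, rfl, rfl, rfl⟩
        refine (mul_eq_zero.1 (?_ : (a - e) * q = 0)).resolve_left hae'
        linear_combination -c10
      · have x1 : q = 0 := by
          refine (mul_eq_zero.1 (?_ : (a - e) * q = 0)).resolve_left hae'
          linear_combination -c10
        subst x1
        obtain ⟨rfl, rfl, rfl⟩ := eq_zero_of_vandermonde hae hag heg t0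
          (by linear_combination t1) (by linear_combination t2)
        refine ⟨rfl, rfl, ?_, rfl, rfl⟩
        refine (mul_eq_zero.1 (?_ : (a - e) * r = 0)).resolve_left hae'
        linear_combination c01
    · have hb := left_ne_zero_of_mul hbd
      have hd := right_ne_zero_of_mul hbd
      obtain rfl := e01.resolve_left hb
      obtain rfl := e10.resolve_left hd
      obtain rfl : s = p := by
        refine sub_eq_zero.1 ((mul_eq_zero.1 (?_ : b * (s - p) = 0)).resolve_left hb)
        linear_combination c01
      obtain rfl : z = -2 * s := by linear_combination t0
      -- If `s ≠ 0`, then `B - g` and its square both have trace zero, hence `det (B - g) = 0`.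
      have x00 : s = 0 := by
        by_contra hx
        have s1 : a + e - 2 * g = 0 := by
          refine (mul_eq_zero.1 (?_ : s * (a + e - 2 * g) = 0)).resolve_left hx
          linear_combination t1
        have s2 : a ^ 2 + 2 * (b * d) + e ^ 2 - 2 * g ^ 2 = 0 := by
          refine (mul_eq_zero.1
            (?_ : s * (a ^ 2 + 2 * (b * d) + e ^ 2 - 2 * g ^ 2) = 0)).resolve_left hx
          linear_combination t2
        exact h (by linear_combination (a + e) / 2 * s1 - s2 / 2)
      rw [x00]; simp
  obtain ⟨rfl, rfl, rfl, rfl, rfl⟩ := key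
  -- With the diagonal part gone, `(x, y)` is a right null vector of the block minus `g`.
  obtain ⟨rfl, rfl⟩ : x = 0 ∧ y = 0 :=
    eq_zero_of_det_ne_zero h (by linear_combination c02) (by linear_combination c12)
  ext i j
  fin_cases i <;> fin_cases j <;> rfl

theorem hasNSMP_blockTri_iff {a b c d e f g : ℝ} : HasNSMP (blockTri a b c d e f g) ↔
    (a - g) * (e - g) ≠ b * d ∧ (b * d = 0 → a ≠ e) := by
  constructor
  · intro H
    have h1 : (a - g) * (e - g) ≠ b * d := fun h => not_hasNSMP_of_eigenvalue h H
    refine ⟨h1, ?_⟩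
    rintro hbd rfl
    refine not_hasNSMP_of_eq hbd ?_ H
    rintro rfl
    simp [hbd] at h1
  · exact fun h => hasNSMP_blockTri h.1 h.2

/-! ### Fixed signings -/

/-- The signs that a symbol stands for. -/
def Symb.hasSign : Symb → SignType → Bool
  | .pos, s => s = 1
  | .neg, s => s = -1
  | .zero, s => s = 0
  | .nonzero, s => s ≠ 0
  | .nonneg, s => s ≠ -1
  | .nonpos, s => s ≠ 1
  | .arb, _ => true

theorem Symb.mem_toSet_iff (S : Symb) (x : ℝ) :
    x ∈ S.toSet ↔ S.hasSign (SignType.sign x) = true := by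
  cases S <;> simp [Symb.toSet, Symb.hasSign, sign_eq_one_iff, sign_eq_neg_one_iff]

/-- The right side is decidable, which opens the classification to `decide`. -/
theorem isFixedSigning_iff {n : ℕ} {A : SignPattern n} {B : SPattern n} :
    IsFixedSigning A B ↔ ∀ i j, (B i j).hasSign (A i j) = true := by
  constructor
  · intro h i j
    have := h (cast_mem_qualClass A) i j
    rwa [Symb.mem_toSet_iff, cast_mem_qualClass A i j] at this
  · intro h M hM i j
    rw [Symb.mem_toSet_iff, hM i j]
    exact h i j

theorem eq_blockTri {R : Type*} [Zero R] {M : Matrix (Fin 3) (Fin 3) R}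
    (h0 : M 2 0 = 0) (h1 : M 2 1 = 0) :
    M = blockTri (M 0 0) (M 0 1) (M 0 2) (M 1 0) (M 1 1) (M 1 2) (M 2 2) := by
  conv_lhs => rw [Matrix.eta_fin_three M, h0, h1]

theorem patternsA_row (i : Fin 6) : patternsA i 2 0 = .zero ∧ patternsA i 2 1 = .zero := by
  fin_cases i <;> exact ⟨rfl, rfl⟩

theorem patternsB_row (i : Fin 6) : patternsB i 2 0 = .zero ∧ patternsB i 2 1 = .zero := by
  fin_cases i <;> exact ⟨rfl, rfl⟩

/-- Signs alone separate the two sides: in order, `0 ≠ b * d`; `a * e < 0 ≤ b * d`; `a * e > 0 > b *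
d`; `(a - g)(e - g) > 0 > b * d`; and, in the last two, three diagonal entries of different signs.
-/
theorem hasNSMP_of_mem_patternsA (i : Fin 6) {M : Matrix (Fin 3) (Fin 3) ℝ}
    (hM : M ∈ (patternsA i).qualClass) : HasNSMP M := by
  have h20 := hM 2 0
  have h21 := hM 2 1
  rw [(patternsA_row i).1] at h20
  rw [(patternsA_row i).2] at h21
  rw [eq_blockTri h20 h21, hasNSMP_blockTri_iff]
  have h00 := hM 0 0
  have h01 := hM 0 1
  have h10 := hM 1 0
  have h11 := hM 1 1
  have h22 := hM 2 2
  generalize M 0 0 = a, M 0 1 = b, M 1 0 = d, M 1 1 = e, M 2 2 = g at *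
  fin_cases i <;> simp [patternsA, Symb.toSet] at h00 h01 h10 h11 h22
  · subst h11 h22
    simp [h01, h10]
  · subst h22
    refine ⟨fun h => ?_, fun _ => by linarith⟩
    nlinarith [mul_pos h00 (neg_pos.2 h11), mul_nonneg h01 h10.le]
  · subst h22
    refine ⟨fun h => ?_, fun h => ?_⟩ <;> nlinarith [mul_pos h00 h11, mul_pos h01 (neg_pos.2 h10)]
  · have hbd := mul_pos h01 (neg_pos.2 h10)
    refine ⟨fun h => ?_, fun h => ?_⟩
    · nlinarith [mul_pos (by linarith : 0 < g - a) (by linarith : 0 < g - e)]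
    · linarith
  · subst h10 h11
    refine ⟨fun h => ?_, fun _ => by linarith⟩
    nlinarith [mul_pos (by linarith : 0 < g - a) h22]
  · subst h00 h10
    refine ⟨fun h => ?_, fun _ => by linarith⟩
    nlinarith [mul_pos (by linarith : 0 < g - e) h22]

theorem requires_of_isFixedSigning_patternsA {A : SignPattern 3} {i : Fin 6}
    (h : IsFixedSigning A (patternsA i)) : Requires A HasNSMP :=
  fun _ hM => hasNSMP_of_mem_patternsA i (h hM)

theorem blockTri_mem_qualClass {a b c d e f g : ℝ} {a' b' c' d' e' f' g' : SignType}
    (ha : SignType.sign a = a') (hb : SignType.sign b = b') (hc : SignType.sign c = c')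
    (hd : SignType.sign d = d') (he : SignType.sign e = e') (hf : SignType.sign f = f')
    (hg : SignType.sign g = g') :
    blockTri a b c d e f g ∈ qualClass (blockTri a' b' c' d' e' f' g') := by
  intro i j
  fin_cases i <;> fin_cases j <;> simp [ha, hb, hc, hd, he, hf, hg]

theorem coe_signType_bounds (s : SignType) : -1 ≤ (s : ℝ) ∧ (s : ℝ) ≤ 1 := by
  cases s <;> norm_num

/-- A sign pattern allows but does not require the nSMP as soon as two realizations differ in
that respect. -/
theorem allows_not_requires_of_blockTri {a' b' c' d' e' f' g' : SignType}
    {a b d e g a₁ b₁ d₁ e₁ g₁ : ℝ}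
    (hs : SignType.sign a = a' ∧ SignType.sign b = b' ∧ SignType.sign d = d' ∧
      SignType.sign e = e' ∧ SignType.sign g = g')
    (hs₁ : SignType.sign a₁ = a' ∧ SignType.sign b₁ = b' ∧ SignType.sign d₁ = d' ∧
      SignType.sign e₁ = e' ∧ SignType.sign g₁ = g')
    (h : (a - g) * (e - g) ≠ b * d ∧ (b * d = 0 → a ≠ e))
    (h₁ : (a₁ - g₁) * (e₁ - g₁) = b₁ * d₁) :
    Allows (blockTri a' b' c' d' e' f' g') HasNSMP ∧
      ¬ Requires (blockTri a' b' c' d' e' f' g') HasNSMP := by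
  obtain ⟨s1, s2, s3, s4, s5⟩ := hs
  obtain ⟨t1, t2, t3, t4, t5⟩ := hs₁
  refine ⟨⟨_, blockTri_mem_qualClass s1 s2 (sign_coe_signType c') s3 s4 (sign_coe_signType f') s5,
    hasNSMP_blockTri_iff.2 h⟩, fun H => ?_⟩
  exact (hasNSMP_blockTri_iff.1 (H _ (blockTri_mem_qualClass t1 t2 (sign_coe_signType c') t3 t4
    (sign_coe_signType f') t5))).1 h₁

theorem allows_not_requires_of_isFixedSigning_patternsB {A : SignPattern 3} {i : Fin 6}
    (h : IsFixedSigning A (patternsB i)) : Allows A HasNSMP ∧ ¬ Requires A HasNSMP := by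
  rw [isFixedSigning_iff] at h
  have h20 := h 2 0
  have h21 := h 2 1
  rw [(patternsB_row i).1] at h20
  rw [(patternsB_row i).2] at h21
  rw [eq_blockTri (M := A) (by simpa [Symb.hasSign] using h20)
    (by simpa [Symb.hasSign] using h21)]
  have h00 := h 0 0
  have h01 := h 0 1
  have h10 := h 1 0
  have h11 := h 1 1
  have h22 := h 2 2
  generalize A 0 0 = a, A 0 1 = b, A 1 0 = d, A 1 1 = e, A 2 2 = g at *
  have sa := sign_coe_signType a
  have se := sign_coe_signType e
  obtain ⟨la, ua⟩ := coe_signType_bounds a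
  obtain ⟨le, ue⟩ := coe_signType_bounds e
  fin_cases i <;> simp [patternsB, Symb.hasSign] at h00 h01 h10 h11 h22
  · subst h00 h01 h10 h11 h22
    exact allows_not_requires_of_blockTri (a := 1) (b := 2) (d := 1) (e := 1) (g := 0)
      (a₁ := 1) (b₁ := 1) (d₁ := 1) (e₁ := 1) (g₁ := 0) (by simp) (by simp) (by norm_num)
      (by norm_num)
  · subst h00 h01 h10 h11 h22
    exact allows_not_requires_of_blockTri (a := 1) (b := 2) (d := -1) (e := -1) (g := 0)
      (a₁ := 1) (b₁ := 1) (d₁ := -1) (e₁ := -1) (g₁ := 0) (by simp) (by simp) (by norm_num)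
      (by norm_num)
  · subst h00 h01 h10 h22
    -- As `e ≤ 1 < g = 2 < a = 3`, the product `(a - g)(e - g)` is negative like `b * d`; `b = 2 -
    -- e` gives equality and doubling `b` destroys it. The next case is similar, with `a, e < g`.
    have hp : 0 < 2 - (e : ℝ) := by linarith
    exact allows_not_requires_of_blockTri (a := 3) (b := 2 * (2 - e)) (d := -1) (e := e) (g := 2)
      (a₁ := 3) (b₁ := 2 - e) (d₁ := -1) (e₁ := e) (g₁ := 2)
      ⟨by simp, sign_pos (by linarith), by simp, se, by simp⟩
      ⟨by simp, sign_pos hp, by simp, se, by simp⟩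
      ⟨fun hh => by linarith, fun hh => by linarith⟩ (by ring)
  · subst h01 h10 h22
    have hp : 0 < (2 - (a : ℝ)) * (2 - (e : ℝ)) := mul_pos (by linarith) (by linarith)
    have hp' : 0 < 2 * ((2 - (a : ℝ)) * (2 - (e : ℝ))) := by linarith
    exact allows_not_requires_of_blockTri
      (a := a) (b := 2 * ((2 - a) * (2 - e))) (d := 1) (e := e) (g := 2)
      (a₁ := a) (b₁ := (2 - a) * (2 - e)) (d₁ := 1) (e₁ := e) (g₁ := 2)
      ⟨sa, sign_pos hp', by simp, se, by simp⟩ ⟨sa, sign_pos hp, by simp, se, by simp⟩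
      ⟨fun hh => by nlinarith, fun hh => by linarith⟩ (by ring)
  · subst h00 h10 h22
    -- Since `e ≤ 1`, the values `2` and `3` make the diagonal distinct, while `a₁ = g₁` repeats an
    -- eigenvalue. The last case does the same with `e` and `g`.
    refine allows_not_requires_of_blockTri (a := 2) (b := b) (d := 0) (e := e) (g := 3)
      (a₁ := 1) (b₁ := b) (d₁ := 0) (e₁ := e) (g₁ := 1)
      ⟨by simp, sign_coe_signType b, by simp, se, by simp⟩
      ⟨by simp, sign_coe_signType b, by simp, se, by simp⟩
      ⟨fun hh => by linarith, fun _ => by linarith⟩ (by ring)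
  · subst h10 h11 h22
    refine allows_not_requires_of_blockTri (a := a) (b := b) (d := 0) (e := 2) (g := 3)
      (a₁ := a) (b₁ := b) (d₁ := 0) (e₁ := 1) (g₁ := 1)
      ⟨sa, sign_coe_signType b, by simp, by simp, by simp⟩
      ⟨sa, sign_coe_signType b, by simp, by simp, by simp⟩
      ⟨fun hh => by linarith, fun _ => by linarith⟩ (by ring)

/-! ### Normal forms of reducible sign patterns of order three -/

theorem equivalent_blockTri_swap (a b c d e f g : SignType) :
    Equivalent (blockTri a b c d e f g) (blockTri e d f b a c g) :=
  .single (.inl ⟨Equiv.swap 0 1, by ext i j; fin_cases i <;> fin_cases j <;> rfl⟩)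

theorem equivalent_blockTri_signature (a b c d e f g : SignType) :
    Equivalent (blockTri a b c d e f g) (blockTri a (-b) (-c) (-d) e f g) := by
  refine .single (.inr (.inl ⟨![-1, 1, 1], fun i => by fin_cases i <;> simp, fun M hM i j => ?_⟩))
  have := hM i j
  fin_cases i <;> fin_cases j <;> simp_all [Matrix.mul_diagonal, Matrix.diagonal_mul, Left.sign_neg]

theorem equivalent_blockTri_neg (a b c d e f g : SignType) :
    Equivalent (blockTri a b c d e f g) (blockTri (-a) (-b) (-c) (-d) (-e) (-f) (-g)) :=
  .single (.inr (.inr (.inr (by ext i j; fin_cases i <;> fin_cases j <;> rfl))))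

/-- Transposition followed by reversal of the indices keeps a triangular pattern upper triangular
and reverses its diagonal. -/
theorem equivalent_blockTri_reverse (a b c e f g : SignType) :
    Equivalent (blockTri a b c 0 e f g) (blockTri g f c 0 e b a) :=
  .trans (.single (.inr (.inr (.inl rfl))))
    (.single (.inl ⟨Fin.revPerm, by ext i j; fin_cases i <;> fin_cases j <;> rfl⟩))

theorem Reducible.exists_blockTri {A : SignPattern 3} (hA : Reducible A) :
    ∃ a b c d e f g : SignType, Equivalent A (blockTri a b c d e f g) := by
  obtain ⟨σ, k, hk, hk', h⟩ := hA
  have hσ : Equivalent A (A.submatrix σ σ) := .single (.inl ⟨σ, rfl⟩)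
  obtain ⟨B, hB, h0, h1⟩ : ∃ B : SignPattern 3, Equivalent A B ∧ B 2 0 = 0 ∧ B 2 1 = 0 := by
    interval_cases k
    -- Blocks of orders 1 and 2 become blocks of orders 2 and 1 under transposition and reversal.
    · refine ⟨(A.submatrix σ σ)ᵀ.submatrix Fin.revPerm Fin.revPerm,
        (hσ.tail (.inr (.inr (.inl rfl)))).tail (.inl ⟨Fin.revPerm, rfl⟩), ?_, ?_⟩
      · exact h 2 0 (by simp) (by simp)
      · exact h 1 0 (by simp) (by simp)
    · exact ⟨_, hσ, h 2 0 (by simp) (by simp), h 2 1 (by simp) (by simp)⟩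
  exact ⟨_, _, _, _, _, _, _, eq_blockTri h0 h1 ▸ hB⟩

/-- `A` is equivalent to a fixed signing of some `Aᵢ` or of some `Bᵢ`, or it does not allow
the nSMP. -/
def Classified (A : SignPattern 3) : Prop :=
  (∃ B i, Equivalent A B ∧ IsFixedSigning B (patternsA i)) ∨
  (∃ B i, Equivalent A B ∧ IsFixedSigning B (patternsB i)) ∨ ¬ Allows A HasNSMP

theorem Equivalent.classified {A B : SignPattern 3} (h : Equivalent A B) (hB : Classified B) :
    Classified A := by
  rcases hB with ⟨C, i, hC, hi⟩ | ⟨C, i, hC, hi⟩ | hB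
  · exact .inl ⟨C, i, h.trans hC, hi⟩
  · exact .inr (.inl ⟨C, i, h.trans hC, hi⟩)
  · exact .inr (.inr fun hA => hB (h.allows_iff.1 hA))

theorem classified_of_patternsA {A : SignPattern 3} (i : Fin 6)
    (h : ∀ k l, (patternsA i k l).hasSign (A k l) = true) : Classified A :=
  .inl ⟨A, i, .refl, isFixedSigning_iff.2 h⟩

theorem classified_of_patternsB {A : SignPattern 3} (i : Fin 6)
    (h : ∀ k l, (patternsB i k l).hasSign (A k l) = true) : Classified A :=
  .inr (.inl ⟨A, i, .refl, isFixedSigning_iff.2 h⟩)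

/-- A triangular matrix with the nSMP needs three distinct diagonal entries. -/
theorem not_allows_of_two_zeros {a b c e f g : SignType}
    (h : a = 0 ∧ e = 0 ∨ a = 0 ∧ g = 0 ∨ e = 0 ∧ g = 0) :
    ¬ Allows (blockTri a b c 0 e f g) HasNSMP := by
  rintro ⟨M, hM, H⟩
  rw [eq_blockTri (sign_eq_zero_iff.1 (hM 2 0)) (sign_eq_zero_iff.1 (hM 2 1)),
    hasNSMP_blockTri_iff, sign_eq_zero_iff.1 (hM 1 0)] at H
  have h0 := hM 0 0
  have h1 := hM 1 1
  have h2 := hM 2 2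
  rcases h with ⟨rfl, rfl⟩ | ⟨rfl, rfl⟩ | ⟨rfl, rfl⟩ <;> simp_all

/-- Up to reversal and negation, the diagonals of the triangular patterns that fall under
one of the patterns `A₅`, `A₆`, `B₅`, `B₆`, or have two zeros. -/
def TriangularForm (a e g : SignType) : Prop :=
  (a = -1 ∧ e = 0 ∧ g = 1) ∨ (a = 0 ∧ e = -1 ∧ g = 1) ∨ (a = 1 ∧ g = 1) ∨
    (a ≠ 1 ∧ e = 1 ∧ g = 1) ∨ (a = 0 ∧ e = 0 ∨ a = 0 ∧ g = 0 ∨ e = 0 ∧ g = 0)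

instance (a e g : SignType) : Decidable (TriangularForm a e g) := by
  unfold TriangularForm; infer_instance

theorem triangularForm_cases : ∀ a e g : SignType, TriangularForm a e g ∨ TriangularForm g e a ∨
    TriangularForm (-a) (-e) (-g) ∨ TriangularForm (-g) (-e) (-a) := by
  decide

theorem TriangularForm.classified {a e g : SignType} (h : TriangularForm a e g)
    (b c f : SignType) : Classified (blockTri a b c 0 e f g) := by
  rcases h with ⟨rfl, rfl, rfl⟩ | ⟨rfl, rfl, rfl⟩ | ⟨rfl, rfl⟩ | ⟨h, rfl, rfl⟩ | h
  · refine classified_of_patternsA 4 ?_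
    revert b c f; decide
  · refine classified_of_patternsA 5 ?_
    revert b c f; decide
  · refine classified_of_patternsB 4 ?_
    revert b c f e; decide
  · refine classified_of_patternsB 5 ?_
    revert b c f a; decide
  · exact .inr (.inr (not_allows_of_two_zeros h))

theorem classified_triangular (a b c e f g : SignType) :
    Classified (blockTri a b c 0 e f g) := by
  rcases triangularForm_cases a e g with h | h | h | h
  · exact h.classified ..
  · exact (equivalent_blockTri_reverse ..).classified (h.classified ..)
  · exact (equivalent_blockTri_neg ..).classified (h.classified ..)
  · exact (equivalent_blockTri_reverse ..).classified
      ((equivalent_blockTri_neg ..).classified (h.classified ..))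

/-- The signs of `[a, 1; d, e]` and `[g]` for which the block triangular pattern falls under
one of `A₁, …, A₄` and `B₁, …, B₄`. -/
def IrreducibleForm (a d e g : SignType) : Prop :=
  (e = 0 ∧ g = 0) ∨ (d = 1 ∧ a = 1 ∧ e = -1 ∧ g = 0) ∨ (d = -1 ∧ a = 1 ∧ e = 1 ∧ g = 0) ∨
    (d = -1 ∧ a ≠ 1 ∧ e ≠ 1 ∧ g = 1) ∨ (d = 1 ∧ a = 1 ∧ e = 1 ∧ g = 0) ∨
    (d = -1 ∧ a = 1 ∧ e = -1 ∧ g = 0) ∨ (d = -1 ∧ a = 1 ∧ g = 1) ∨ (d = 1 ∧ g = 1)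

instance (a d e g : SignType) : Decidable (IrreducibleForm a d e g) := by
  unfold IrreducibleForm; infer_instance

theorem irreducibleForm_cases : ∀ a d e g : SignType, d ≠ 0 → IrreducibleForm a d e g ∨
    IrreducibleForm e d a g ∨ IrreducibleForm (-a) d (-e) (-g) ∨
    IrreducibleForm (-e) d (-a) (-g) := by
  decide

theorem IrreducibleForm.classified {a d e g : SignType} (hd : d ≠ 0)
    (h : IrreducibleForm a d e g) (c f : SignType) : Classified (blockTri a 1 c d e f g) := by
  rcases h with ⟨rfl, rfl⟩ | ⟨rfl, rfl, rfl, rfl⟩ | ⟨rfl, rfl, rfl, rfl⟩ | ⟨rfl, ha, he, rfl⟩ |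
    ⟨rfl, rfl, rfl, rfl⟩ | ⟨rfl, rfl, rfl, rfl⟩ | ⟨rfl, rfl, rfl⟩ | ⟨rfl, rfl⟩
  · refine classified_of_patternsA 0 ?_
    revert a c d f; decide
  · refine classified_of_patternsA 1 ?_
    revert c f; decide
  · refine classified_of_patternsA 2 ?_
    revert c f; decide
  · refine classified_of_patternsA 3 ?_
    revert a e c f; decide
  · refine classified_of_patternsB 0 ?_
    revert c f; decide
  · refine classified_of_patternsB 1 ?_
    revert c f; decide
  · refine classified_of_patternsB 2 ?_
    revert e c f; decide
  · refine classified_of_patternsB 3 ?_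
    revert a e c f; decide

/-- A signature similarity flips `b` and `d` together, so only their product matters. -/
theorem equivalent_blockTri_one (a c e f g : SignType) {b d : SignType} (hb : b ≠ 0) :
    ∃ c', Equivalent (blockTri a b c d e f g) (blockTri a 1 c' (b * d) e f g) := by
  rcases SignType.trichotomy b with rfl | rfl | rfl
  · exact ⟨-c, by simpa using equivalent_blockTri_signature a (-1) c d e f g⟩
  · exact absurd rfl hb
  · exact ⟨c, by rw [one_mul]; exact .refl⟩

theorem IrreducibleForm.classified_of_mul {a b d e g : SignType} (hb : b ≠ 0) (hd : d ≠ 0)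
    (h : IrreducibleForm a (b * d) e g) (c f : SignType) :
    Classified (blockTri a b c d e f g) := by
  obtain ⟨c', hc'⟩ := equivalent_blockTri_one a c e f g (d := d) hb
  exact hc'.classified (h.classified (mul_ne_zero hb hd) c' f)

/-- Swapping exchanges `b` and `d`, and negation flips both. Either way `b * d` is unchanged, so
only the signs of the diagonal need to be followed. -/
theorem classified_irreducible (a c e f g : SignType) {b d : SignType} (hb : b ≠ 0) (hd : d ≠ 0) :
    Classified (blockTri a b c d e f g) := by
  have hb' : -b ≠ 0 := by revert b; decide
  have hd' : -d ≠ 0 := by revert d; decide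
  have hbd : -b * -d = b * d := by revert b d; decide
  rcases irreducibleForm_cases a (b * d) e g (mul_ne_zero hb hd) with h | h | h | h
  · exact h.classified_of_mul hb hd ..
  · rw [mul_comm] at h
    exact (equivalent_blockTri_swap ..).classified (h.classified_of_mul hd hb ..)
  · rw [← hbd] at h
    exact (equivalent_blockTri_neg ..).classified (h.classified_of_mul hb' hd' ..)
  · rw [← hbd, mul_comm] at h
    exact (equivalent_blockTri_swap ..).classified
      ((equivalent_blockTri_neg ..).classified (h.classified_of_mul hd' hb' ..))

theorem Reducible.classified {A : SignPattern 3} (hA : Reducible A) : Classified A := by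
  obtain ⟨a, b, c, d, e, f, g, h⟩ := hA.exists_blockTri
  refine h.classified ?_
  by_cases hd : d = 0
  · subst hd
    exact classified_triangular ..
  by_cases hb : b = 0
  · subst hb
    exact (equivalent_blockTri_swap ..).classified (classified_triangular ..)
  · exact classified_irreducible _ _ _ _ _ hb hd

end NSMP

theorem mainTheorem10 (A : NSMP.SignPattern 3) (hA : NSMP.Reducible A) :
    (NSMP.Requires A NSMP.HasNSMP ↔
      ∃ (B : NSMP.SignPattern 3) (i : Fin 6),
        NSMP.Equivalent A B ∧ NSMP.IsFixedSigning B (NSMP.patternsA i)) ∧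
    ((NSMP.Allows A NSMP.HasNSMP ∧ ¬ NSMP.Requires A NSMP.HasNSMP) ↔
      ∃ (B : NSMP.SignPattern 3) (i : Fin 6),
        NSMP.Equivalent A B ∧ NSMP.IsFixedSigning B (NSMP.patternsB i)) := by
  have hreq : (∃ (B : NSMP.SignPattern 3) (i : Fin 6), NSMP.Equivalent A B ∧
      NSMP.IsFixedSigning B (NSMP.patternsA i)) → NSMP.Requires A NSMP.HasNSMP := by
    rintro ⟨B, i, hAB, hB⟩
    exact hAB.requires_iff.2 (NSMP.requires_of_isFixedSigning_patternsA hB)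
  have hall : (∃ (B : NSMP.SignPattern 3) (i : Fin 6), NSMP.Equivalent A B ∧
      NSMP.IsFixedSigning B (NSMP.patternsB i)) →
      NSMP.Allows A NSMP.HasNSMP ∧ ¬ NSMP.Requires A NSMP.HasNSMP := by
    rintro ⟨B, i, hAB, hB⟩
    rw [hAB.requires_iff, hAB.allows_iff]
    exact NSMP.allows_not_requires_of_isFixedSigning_patternsB hB
  refine ⟨⟨fun h => ?_, hreq⟩, ⟨fun h => ?_, hall⟩⟩
  · rcases hA.classified with hc | hc | hc
    · exact hc
    · exact absurd h (hall hc).2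
    · exact absurd h.allows hc
  · rcases hA.classified with hc | hc | hc
    · exact absurd (hreq hc) h.2
    · exact hc
    · exact absurd h.1 hc
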